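/- Let $\kappa$ be a cardinal and let $\mathcal U$ be a nonprincipal ultrafilter on $\kappa$ that is ${<}\kappa$-complete (closed under intersections of fewer than $\kappa$ of its members). For $\lambda<\kappa$, a $\bar\lambda$-slalom is a function $\phi$ on $\kappa$ with $\phi(\alpha)\subseteq\kappa$ and $|\phi(\alpha)|<|\lambda|$ for all $\alpha<\kappa$. The $\kappa$-eventually different forcing $\mathbb E_\kappa$ consists of the pairs $(s,\phi)$ with $s\in{}^{<\kappa}\kappa$ (the stem) and $\phi$ a $\bar\lambda$-slalom for some $\lambda<\kappa$; the least such $\lambda$ is the width of $(s,\phi)$. It is ordered by $(t,\psi)\le(s,\phi)$ iff $s\subseteq t$, $\phi(\alpha)\subseteq\psi(\alpha)$ for all $\alpha<\kappa$, and $t(\alpha)\notin\phi(\alpha)$ for all $\alpha\in\operatorname{dom}(t)\setminus\operatorname{dom}(s)$. Let $E_{s,\lambda}$ be the set of conditions with stem $s$ and width $\lambda$. For a forcing notion $\mathbb P$ and a filter $\mathcal F$ on $\kappa$, a set $Q\subseteq\mathbb P$ is called $\mathcal F$-linked if for every sequence $\langle p_\alpha\mid\alpha<\kappa\rangle$ of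 conditions in $Q$ there is $q\in\mathbb P$ which forces that $\{\alpha<\kappa\mid p_\alpha\in\dot G\}$ is positive for (that is, meets every member of) the filter on $\kappa$ generated by $\mathcal F$ in the extension, where $\dot G$ names the generic filter. $\mathbb P$ is called $(\mu,\mathcal F)$-linked if it is a union of $\mu$ many $\mathcal F$-linked subsets. Then $\mathbb E_\kappa$ is $(\kappa,\mathcal U)$-linked. More precisely, there are exactly $\kappa$ many pairs $(s,\lambda)$ with $s\in{}^{<\kappa}\kappa$ and $\lambda<\kappa$, the sets $E_{s,\lambda}$ are pairwise disjoint with union $\mathbb E_\kappa$, and each $E_{s,\lambda}$ is $\mathcal U$-linked. -/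

import Mathlib

open Cardinal

universe u

noncomputable section

/-! ### Names, check names and the forcing relation

The ground model is the cumulative hierarchy `PSet.{u}` over `Type u`; a notion of forcing is a
preorder `P : Type u`, where `q ≤ p` means that `q` is stronger than `p`. -/

/-- `P`-names: a name is a (small, indexed) family of pairs (name, condition). -/
inductive ForcingName (P : Type u) : Type (u + 1)
  | mk (ι : Type u) (name : ι → ForcingName P) (cond : ι → P) : ForcingName P

/-- The canonical name `x̌` of a ground model set `x`, namely `{(y̌, p) : y ∈ x, p ∈ P}`. -/
def ForcingName.check (P : Type u) : PSet.{u} → ForcingName P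
  | ⟨ι, A⟩ => .mk (ι × P) (fun i => ForcingName.check P (A i.1)) (fun i => i.2)

/-- `ForcesEq a b p` is `p ⊩ a = b`: for each `(aᵢ, sᵢ)` in `a`, below `p` and `sᵢ` it is dense to
force `aᵢ = bⱼ` for some `(bⱼ, tⱼ)` in `b` with `tⱼ` in the generic filter, and vice versa. -/
def ForcesEq {P : Type u} [Preorder P] : ForcingName P → ForcingName P → P → Prop
  | .mk ι a s, .mk ι' b t => fun p =>
    (∀ i : ι, ∀ q ≤ p, q ≤ s i → ∃ r ≤ q, ∃ j : ι', r ≤ t j ∧ ForcesEq (a i) (b j) r) ∧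
    (∀ j : ι', ∀ q ≤ p, q ≤ t j → ∃ r ≤ q, ∃ i : ι, r ≤ s i ∧ ForcesEq (a i) (b j) r)

/-- `ForcesMem a b p` is `p ⊩ a ∈ b`: below `p` it is dense to force `a = bⱼ` for some
`(bⱼ, tⱼ)` in `b` with `tⱼ` in the generic filter. -/
def ForcesMem {P : Type u} [Preorder P] (a : ForcingName P) : ForcingName P → P → Prop
  | .mk ι b t => fun p => ∀ q ≤ p, ∃ r ≤ q, ∃ j : ι, r ≤ t j ∧ ForcesEq a (b j) r

/-- Sentences of the forcing language: set-theoretic sentences with names as parameters. -/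
inductive ForcingSentence (P : Type u) : Type (u + 1)
  | eq (a b : ForcingName P) : ForcingSentence P
  | mem (a b : ForcingName P) : ForcingSentence P
  | not (φ : ForcingSentence P) : ForcingSentence P
  | and (φ ψ : ForcingSentence P) : ForcingSentence P
  | all (φ : ForcingName P → ForcingSentence P) : ForcingSentence P

/-- The forcing relation `p ⊩ φ`. -/
def Forces {P : Type u} [Preorder P] : P → ForcingSentence P → Prop
  | p, .eq a b => ForcesEq a b p
  | p, .mem a b => ForcesMem a b p
  | p, .not φ => ∀ q ≤ p, ¬ Forces q φ
  | p, .and φ ψ => Forces p φ ∧ Forces p ψ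
  | p, .all φ => ∀ x : ForcingName P, Forces p (φ x)

namespace ForcingSentence

variable {P : Type u}

/-- `φ → ψ`. -/
def imp (φ ψ : ForcingSentence P) : ForcingSentence P := .not (.and φ (.not ψ))

/-- `∃ x, φ x`. -/
def ex (φ : ForcingName P → ForcingSentence P) : ForcingSentence P := .not (.all fun x => .not (φ x))

/-- `a ⊆ b`. -/
def subset (a b : ForcingName P) : ForcingSentence P := .all fun z => imp (.mem z a) (.mem z b)

/-- "`X` belongs to the filter on `k` generated by `F`": `X ⊆ k` and `X` has a subset in `F`.
(Here `F` will be a filter of the ground model, which is closed under finite intersections.) -/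
def inGenFilter (k F X : ForcingName P) : ForcingSentence P :=
  .and (subset X k) (ex fun A => .and (.mem A F) (subset A X))

/-- "`W` is a positive set for the filter on `k` generated by `F`": `W ⊆ k` and `W` meets every
set in that filter. -/
def isPositive (k F W : ForcingName P) : ForcingSentence P :=
  .and (subset W k)
    (.all fun X => imp (inGenFilter k F X) (ex fun z => .and (.mem z X) (.mem z W)))

end ForcingSentence

/-! ### Linkedness with respect to a filter

The cardinal `κ`, as the set of ordinals below it, is the well-order `κ.ord.ToType`. -/

/-- The ordinal `α < κ` as a (von Neumann ordinal) set of the ground model. -/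
def ordSet {κ : Cardinal.{u}} (α : κ.ord.ToType) : PSet.{u} :=
  Ordinal.toPSet (Ordinal.ToType.toOrd α : Ordinal.{u})

/-- The cardinal `κ` as a (von Neumann ordinal) set of the ground model. -/
def cardSet (κ : Cardinal.{u}) : PSet.{u} := ⟨κ.ord.ToType, ordSet⟩

/-- A subset of `κ` as a set of the ground model. -/
def subsetSet {κ : Cardinal.{u}} (A : Set κ.ord.ToType) : PSet.{u} := ⟨A, fun α => ordSet α.1⟩

/-- A filter on `κ` as a set (of subsets of `κ`) of the ground model. -/
def filterSet {κ : Cardinal.{u}} (F : Filter κ.ord.ToType) : PSet.{u} :=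
  ⟨F.sets, fun A => subsetSet A.1⟩

/-- The name `{(α̌, p_α) : α < κ}` of the set `{α < κ : p_α ∈ G}`, with `G` the generic filter. -/
def genericIndexName {P : Type u} {κ : Cardinal.{u}} (p : κ.ord.ToType → P) : ForcingName P :=
  .mk κ.ord.ToType (fun α => .check P (ordSet α)) p

/-- `Q ⊆ P` is `F`-linked: for each `κ`-sequence `p` in `Q` some condition forces that
`{α < κ : p_α ∈ G}` is positive for the filter generated by `F` in the extension. -/
def IsFilterLinked {P : Type u} [Preorder P] {κ : Cardinal.{u}} (F : Filter κ.ord.ToType)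
    (Q : Set P) : Prop :=
  ∀ p : κ.ord.ToType → P, (∀ α, p α ∈ Q) →
    ∃ q : P, Forces q (.isPositive (.check P (cardSet κ)) (.check P (filterSet F))
      (genericIndexName p))

/-- `P` is `(μ, F)`-linked: it is a union of `μ` many `F`-linked subsets. -/
def IsCardFilterLinked (P : Type u) [Preorder P] (μ : Cardinal.{u}) {κ : Cardinal.{u}}
    (F : Filter κ.ord.ToType) : Prop :=
  ∃ Q : μ.ord.ToType → Set P, (⋃ α, Q α) = Set.univ ∧ ∀ α, IsFilterLinked F (Q α)

/-! ### `κ`-eventually different forcing -/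

/-- `φ` is an `h`-slalom: `|φ(α)| < |h(α)|` for all `α < κ`. -/
def IsSlalom {κ : Cardinal.{u}} (h : κ.ord.ToType → κ.ord.ToType)
    (φ : κ.ord.ToType → Set κ.ord.ToType) : Prop :=
  ∀ α, #(φ α) < (Ordinal.ToType.toOrd (h α) : Ordinal.{u}).card

/-- Elements of `^{<κ}κ`: functions `s : len → κ` with `len < κ`. -/
structure ShortSeq (κ : Cardinal.{u}) : Type u where
  len : κ.ord.ToType
  val : Set.Iio len → κ.ord.ToType

/-- Conditions of `κ`-eventually different forcing: pairs of a stem in `^{<κ}κ` and a promise, which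
is a `λ`-slalom for some constant `λ < κ`. -/
structure EvDiff (κ : Cardinal.{u}) : Type u where
  stem : ShortSeq κ
  promise : κ.ord.ToType → Set κ.ord.ToType
  isSlalom_promise : ∃ l : κ.ord.ToType, IsSlalom (fun _ => l) promise

namespace EvDiff

variable {κ : Cardinal.{u}}

/-- `(t, ψ) ≤ (s, φ)` iff `s ⊆ t`, `φ(α) ⊆ ψ(α)` for all `α < κ`, and `t(α) ∉ φ(α)` for all
`α ∈ dom t \ dom s`. -/
instance : Preorder (EvDiff κ) where
  le q p :=
    (∃ h : p.stem.len ≤ q.stem.len,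
      ∀ α (hα : α < p.stem.len), q.stem.val ⟨α, hα.trans_le h⟩ = p.stem.val ⟨α, hα⟩) ∧
    (∀ α, p.promise α ⊆ q.promise α) ∧
    (∀ α (hα : α < q.stem.len), p.stem.len ≤ α → q.stem.val ⟨α, hα⟩ ∉ p.promise α)
  le_refl p := ⟨⟨le_rfl, fun _ _ => rfl⟩, fun _ => subset_rfl, fun _ h h' => absurd h h'.not_gt⟩
  le_trans := by
    rintro r q p ⟨⟨h₁, e₁⟩, i₁, a₁⟩ ⟨⟨h₂, e₂⟩, i₂, a₂⟩
    refine ⟨⟨h₂.trans h₁, fun α hα => ?_⟩, fun α => (i₂ α).trans (i₁ α), fun α hα hp hm => ?_⟩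
    · rw [e₁ α (hα.trans_le h₂), e₂ α hα]
    · rcases lt_or_ge α q.stem.len with hq | hq
      · exact a₂ α hq hp (e₁ α hq ▸ hm)
      · exact a₁ α hα hq (i₂ α hm)

/-- `l < κ` is the width of `p`: the least `l` such that the promise of `p` is a slalom for the
constant function with value `l`. -/
def IsWidth (p : EvDiff κ) (l : κ.ord.ToType) : Prop :=
  IsLeast {m | IsSlalom (fun _ => m) p.promise} l

/-- `E_{s,l}`: the set of conditions with stem `s` and width `l`. -/
def piece (s : ShortSeq κ) (l : κ.ord.ToType) : Set (EvDiff κ) := {p | p.stem = s ∧ p.IsWidth l}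

end EvDiff

end

/-! Given conditions `p α` with common stem `s` and width `l`, let `q` have stem `s` and as promise
the `U`-limit of their promises. If `r ≤ q`, each new value of the stem of `r` avoids the limit,
hence avoids the promise of `p α` for `U`-almost all `α`. The stem of `r` has length below `κ`, so
by completeness `U`-almost all `α` work for all its values at once; any such `α` in a given `A ∈ U`
makes `r` and `p α` compatible, via the union of their promises. By density `q` forces positivity
(`forces_isPositive_genericIndexName`). `isSlalom_limitPromise` makes `q` a condition. There are
only `κ` pieces because `U` makes `κ` a regular strong limit, whence `κ^{<κ} = κ`. -/

namespace ForcingName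

variable {P : Type u} [Preorder P]

theorem forcesEq_refl : ∀ (a : ForcingName P) (p : P), ForcesEq a a p
  | .mk _ a _, _ => ⟨fun i q _ hs => ⟨q, le_rfl, i, hs, forcesEq_refl (a i) q⟩,
      fun i q _ hs => ⟨q, le_rfl, i, hs, forcesEq_refl (a i) q⟩⟩

theorem forcesEq_mono {a b : ForcingName P} {p q : P} (h : ForcesEq a b p) (hq : q ≤ p) :
    ForcesEq a b q := by
  cases a; cases b
  exact ⟨fun i r hr => h.1 i r (hr.trans hq), fun j r hr => h.2 j r (hr.trans hq)⟩

theorem forcesMem_of_forcesEq {ι : Type u} {a : ForcingName P} {b : ι → ForcingName P} {t : ι → P}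
    {p : P} (i : ι) (hp : p ≤ t i) (h : ForcesEq a (b i) p) : ForcesMem a (.mk ι b t) p :=
  fun q hq => ⟨q, le_rfl, i, hq.trans hp, forcesEq_mono h hq⟩

theorem exists_forcesEq_of_forcesMem_check {a : ForcingName P} {ι : Type u} {A : ι → PSet.{u}}
    {p : P} (h : ForcesMem a (.check P ⟨ι, A⟩) p) :
    ∃ r ≤ p, ∃ i, ForcesEq a (.check P (A i)) r := by
  obtain ⟨r, hr, i, -, e⟩ := h p le_rfl
  exact ⟨r, hr, i.1, e⟩

theorem forcesMem_check {a : ForcingName P} {ι : Type u} {A : ι → PSet.{u}} {p : P} (i : ι)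
    (h : ForcesEq a (.check P (A i)) p) : ForcesMem a (.check P ⟨ι, A⟩) p :=
  forcesMem_of_forcesEq (b := fun i : ι × P => .check P (A i.1)) (i, p) le_rfl h

/-- A name forced equal to a check name is forced to have an element equal to each of its
elements. -/
theorem exists_forcesMem_of_forcesEq_check {a : ForcingName P} {ι : Type u} {A : ι → PSet.{u}}
    {p : P} (h : ForcesEq a (.check P ⟨ι, A⟩) p) (i : ι) :
    ∃ r ≤ p, ∃ z, ForcesMem z a r ∧ ForcesEq z (.check P (A i)) r := by
  obtain ⟨κ, b, s⟩ := a
  obtain ⟨r, hr, j, hj, e⟩ := h.2 (i, p) p le_rfl le_rfl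
  exact ⟨r, hr, b j, forcesMem_of_forcesEq j hj (forcesEq_refl _ _), e⟩

end ForcingName

namespace ForcingSentence

open ForcingName

variable {P : Type u} [Preorder P]

theorem forces_imp_iff {φ ψ : ForcingSentence P} {p : P} :
    Forces p (imp φ ψ) ↔ ∀ q ≤ p, Forces q φ → ∃ r ≤ q, Forces r ψ := by
  simp only [imp, Forces, not_and, not_forall, not_not, exists_prop]

theorem forces_ex_iff {φ : ForcingName P → ForcingSentence P} {p : P} :
    Forces p (ex φ) ↔ ∀ q ≤ p, ∃ x, ∃ r ≤ q, Forces r (φ x) := by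
  simp only [ex, Forces, not_forall, not_not, exists_prop]

/-- Reduces linkedness to compatibility: a set in the generated filter contains, below some
condition, a fixed ground model `A ∈ F`, so it suffices to put some `p α` with `α ∈ A` into the
generic filter. -/
theorem forces_isPositive_genericIndexName {κ : Cardinal.{u}} {F : Filter κ.ord.ToType}
    {p : κ.ord.ToType → P} {q : P}
    (h : ∀ r ≤ q, ∀ A ∈ F, ∃ α ∈ A, ∃ r' ≤ r, r' ≤ p α) :
    Forces q (.isPositive (.check P (cardSet κ)) (.check P (filterSet F))
      (genericIndexName p)) := by
  refine ⟨fun z => forces_imp_iff.2 fun r _ hz => ?_, fun X => forces_imp_iff.2 fun r hr hX =>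
    ⟨r, le_rfl, forces_ex_iff.2 fun r₁ hr₁ => ?_⟩⟩
  · obtain ⟨r', hr', α, -, e⟩ := hz r le_rfl
    exact ⟨r', hr', forcesMem_check (A := ordSet) α e⟩
  · obtain ⟨N, r₂, hr₂, hN, hsub⟩ := forces_ex_iff.1 hX.2 r₁ hr₁
    obtain ⟨r₃, hr₃, A, hA⟩ := exists_forcesEq_of_forcesMem_check
      (A := fun A : F.sets => subsetSet A.1) hN
    obtain ⟨α, hα, r₄, hr₄, hp⟩ :=
      h r₃ (hr₃.trans (hr₂.trans (hr₁.trans hr))) A.1 A.2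
    obtain ⟨r₅, hr₅, z, hz, e⟩ := exists_forcesMem_of_forcesEq_check
      (A := fun α : A.1 => ordSet α.1) (forcesEq_mono hA hr₄) ⟨α, hα⟩
    obtain ⟨r₆, hr₆, hzX⟩ :=
      forces_imp_iff.1 (hsub z) r₅ (hr₅.trans (hr₄.trans hr₃)) hz
    exact ⟨z, r₆, hr₆.trans (hr₅.trans (hr₄.trans (hr₃.trans hr₂))), hzX,
      forcesMem_of_forcesEq α (hr₆.trans (hr₅.trans hp)) (forcesEq_mono e hr₆)⟩

end ForcingSentence

/-! ### Cardinal arithmetic from a complete nonprincipal ultrafilter -/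

namespace Cardinal

variable {κ : Cardinal.{u}}

theorem aleph0_le_of_nonprincipal (U : Ultrafilter κ.ord.ToType) (hU : ∀ α, U ≠ pure α) :
    ℵ₀ ≤ κ := by
  by_contra! h
  have : Finite κ.ord.ToType := by rwa [← lt_aleph0_iff_finite, mk_ord_toType]
  obtain ⟨α, hα⟩ := U.eq_pure_of_finite
  exact hU α hα

variable {U : Ultrafilter κ.ord.ToType} [CardinalInterFilter (U : Filter κ.ord.ToType) κ]

theorem compl_mem_of_mk_lt (hU : ∀ α, U ≠ pure α) {A : Set κ.ord.ToType} (hA : #A < κ) :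
    Aᶜ ∈ U := by
  have h : (⋂ a : A, ({a.1}ᶜ : Set κ.ord.ToType)) ∈ (U : Filter κ.ord.ToType) := by
    refine (Filter.cardinal_iInter_mem hA).2 fun a => ?_
    rw [Ultrafilter.mem_coe, Ultrafilter.compl_mem_iff_notMem]
    intro ha
    obtain ⟨x, -, hx⟩ := Ultrafilter.eq_pure_of_finite_mem (Set.finite_singleton _) ha
    exact hU x hx
  filter_upwards [h] with x hx hxA
  exact Set.mem_iInter.1 hx ⟨x, hxA⟩ rfl

/-- Proper initial segments are `U`-null, so fewer than `κ` of them cannot cover `κ`. -/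
theorem isRegular_of_nonprincipal (hU : ∀ α, U ≠ pure α) : κ.IsRegular := by
  have hκ := aleph0_le_of_nonprincipal U hU
  refine ⟨hκ, ?_⟩
  rw [← Ordinal.cof_toType, Order.le_cof_iff]
  intro S hS
  by_contra! h
  have h' : (⋂ a : S, (Set.Iic a.1)ᶜ) ∈ (U : Filter κ.ord.ToType) := by
    refine (Filter.cardinal_iInter_mem h).2 fun a => compl_mem_of_mk_lt hU ?_
    rw [← Set.Iio_insert]
    have h1 : #(Set.Iio a.1) < κ := by simpa using mk_Iio_lt a.1
    exact mk_insert_le.trans_lt (add_lt_of_lt hκ h1 (one_lt_aleph0.trans_le hκ))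
  obtain ⟨x, hx⟩ := U.nonempty_of_mem h'
  obtain ⟨a, ha, hxa⟩ := hS x
  exact Set.mem_iInter.1 hx ⟨a, ha⟩ hxa

/-- Otherwise `κ` injects into the subsets of some `ι` of size below `κ`. `U` decides each `i ∈ f
x`; by completeness `U`-almost all `x` follow every decision, hence share one value of `f`, and `U`
is principal. -/
theorem isStrongPrelimit_of_nonprincipal (hU : ∀ α, U ≠ pure α) : κ.IsStrongPrelimit := by
  intro l hl
  by_contra! h
  induction l using Cardinal.inductionOn with | mk ι
  rw [← mk_ord_toType κ, ← mk_set] at h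
  obtain ⟨f⟩ := h
  have h₁ (i : ι) : ∀ᶠ x in U, i ∈ f x ↔ ∀ᶠ y in U, i ∈ f y := by
    by_cases hi : ∀ᶠ y in U, i ∈ f y
    · simp [hi]
    · simpa [hi] using Ultrafilter.eventually_not.2 hi
  have h₂ : ∀ᶠ x in (U : Filter κ.ord.ToType), ∀ i, i ∈ f x ↔ ∀ᶠ y in U, i ∈ f y :=
    (Filter.eventually_cardinal_forall hl).2 h₁
  obtain ⟨x, -, hx⟩ := Ultrafilter.eq_pure_of_finite_mem (f := U) (Set.Subsingleton.finite
    fun x hx y hy => f.injective (Set.ext fun i => (hx i).trans (hy i).symm)) h₂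
  exact hU x hx

theorem mk_shortSeq (hκ : κ.IsRegular) (hκ' : κ.IsStrongPrelimit) : #(ShortSeq κ) = κ := by
  have hne : Nonempty κ.ord.ToType := by
    rw [← mk_ne_zero_iff, mk_ord_toType]
    exact hκ.ne_zero
  refine le_antisymm ?_ ?_
  · have hprod : #(κ.ord.ToType × κ.ord.ToType) = κ := by
      simp [mul_eq_self hκ.aleph0_le]
    -- A short sequence is coded by its length and its graph, a subset of `κ × κ` of size below `κ`;
    -- there are only `κ` such subsets.
    have hsmall := mk_subset_mk_lt_cof (α := κ.ord.ToType × κ.ord.ToType) (hprod.symm ▸ hκ')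
    rw [hprod, hκ.cof_ord] at hsmall
    have hlt (s : ShortSeq κ) :
        #(Set.range fun i : Set.Iio s.len => ((i : κ.ord.ToType), s.val i)) < κ :=
      mk_range_le.trans_lt (by simpa using mk_Iio_lt s.len)
    let g (s : ShortSeq κ) : κ.ord.ToType × {t : Set (κ.ord.ToType × κ.ord.ToType) // #t < κ} :=
      (s.len, ⟨_, hlt s⟩)
    have hg : Function.Injective g := by
      rintro ⟨l, v⟩ ⟨l', v'⟩ h
      obtain rfl : l = l' := congrArg Prod.fst h
      congr
      funext i
      have hv : ((i : κ.ord.ToType), v i) ∈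
          Set.range fun i : Set.Iio l => ((i : κ.ord.ToType), v' i) :=
        (Set.ext_iff.1 (congrArg (fun x => x.2.1) h) _).1 (Set.mem_range_self i)
      obtain ⟨j, hj⟩ := hv
      obtain rfl : j = i := Subtype.ext (congrArg Prod.fst hj)
      exact (congrArg Prod.snd hj).symm
    refine (mk_le_of_injective hg).trans ?_
    simp [hsmall, mul_eq_self hκ.aleph0_le]
  · conv_lhs => rw [← mk_ord_toType κ]
    exact mk_le_of_injective (f := fun l => (⟨l, fun _ => Classical.arbitrary _⟩ : ShortSeq κ))
      fun _ _ h => congrArg ShortSeq.len h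

end Cardinal

/-! ### Ultrafilter limits of promises -/

namespace EvDiff

variable {κ : Cardinal.{u}}

theorem card_toOrd_lt (l : κ.ord.ToType) :
    (Ordinal.ToType.toOrd l : Ordinal.{u}).card < κ :=
  lt_ord.1 (Ordinal.ToType.toOrd l).2

theorem exists_card_toOrd_eq {c : Cardinal.{u}} (hc : c < κ) :
    ∃ l : κ.ord.ToType, (Ordinal.ToType.toOrd l : Ordinal.{u}).card = c :=
  ⟨Ordinal.ToType.mk ⟨c.ord, ord_lt_ord.2 hc⟩, by simp⟩

theorem isSlalom_union (hκ : ℵ₀ ≤ κ) {φ ψ : κ.ord.ToType → Set κ.ord.ToType}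
    (hφ : ∃ l, IsSlalom (fun _ => l) φ) (hψ : ∃ l, IsSlalom (fun _ => l) ψ) :
    ∃ l, IsSlalom (fun _ => l) fun α => φ α ∪ ψ α := by
  obtain ⟨l, hl⟩ := hφ
  obtain ⟨m, hm⟩ := hψ
  obtain ⟨n, hn⟩ := exists_card_toOrd_eq (add_lt_of_lt hκ (card_toOrd_lt l) (card_toOrd_lt m))
  exact ⟨n, fun α => (mk_union_le _ _).trans_lt (hn ▸ Cardinal.add_lt_add (hl α) (hm α))⟩

theorem exists_isWidth (p : EvDiff κ) : ∃ l, p.IsWidth l :=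
  have h := p.isSlalom_promise
  ⟨_, wellFounded_lt.min_mem _ h, fun _ hm => wellFounded_lt.min_le hm⟩

theorem iUnion_piece :
    (⋃ sl : ShortSeq κ × κ.ord.ToType, piece sl.1 sl.2) = Set.univ :=
  Set.eq_univ_of_forall fun p =>
    let ⟨l, hl⟩ := p.exists_isWidth
    Set.mem_iUnion.2 ⟨(p.stem, l), rfl, hl⟩

theorem disjoint_piece {sl sl' : ShortSeq κ × κ.ord.ToType} (h : sl ≠ sl') :
    Disjoint (piece sl.1 sl.2) (piece sl'.1 sl'.2) :=
  Set.disjoint_left.2 fun _ h₁ h₂ =>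
    h (Prod.ext (h₁.1.symm.trans h₂.1) (h₁.2.unique h₂.2))

/-- The ultrafilter limit of a sequence of slaloms. -/
def limitPromise (U : Ultrafilter κ.ord.ToType)
    (φ : κ.ord.ToType → κ.ord.ToType → Set κ.ord.ToType) (β : κ.ord.ToType) :
    Set κ.ord.ToType :=
  {ξ | ∀ᶠ α in U, ξ ∈ φ α β}

variable (U : Ultrafilter κ.ord.ToType) [CardinalInterFilter (U : Filter κ.ord.ToType) κ]

/-- If the limit at `β` had at least `|l|` points, completeness would put `|l|` of them into a
single `φ α β`. -/
theorem isSlalom_limitPromise {l : κ.ord.ToType}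
    {φ : κ.ord.ToType → κ.ord.ToType → Set κ.ord.ToType}
    (h : ∀ α, IsSlalom (fun _ => l) (φ α)) : IsSlalom (fun _ => l) (limitPromise U φ) := by
  intro β
  by_contra! hle
  obtain ⟨t, ht, htl⟩ := le_mk_iff_exists_subset.1 hle
  have hmem : ∀ᶠ α in (U : Filter κ.ord.ToType), ∀ ξ : t, ξ.1 ∈ φ α β :=
    (Filter.eventually_cardinal_forall (htl.trans_lt (card_toOrd_lt l))).2 fun ξ => ht ξ.2
  obtain ⟨α, hα⟩ := hmem.exists
  exact (h α β).not_ge (htl ▸ mk_le_mk_of_subset fun ξ hξ => hα ⟨ξ, hξ⟩)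

theorem isFilterLinked_piece (hκ : ℵ₀ ≤ κ) (s : ShortSeq κ) (l : κ.ord.ToType) :
    IsFilterLinked (U : Filter κ.ord.ToType) (piece s l) := by
  intro p hp
  -- The width of this condition may drop below `l`; it need not lie in the piece.
  refine ⟨⟨s, limitPromise U fun α => (p α).promise, l,
    isSlalom_limitPromise U fun α => (hp α).2.1⟩,
    ForcingSentence.forces_isPositive_genericIndexName ?_⟩
  rintro r ⟨⟨hlen, hval⟩, -, havoid⟩ A hA
  have hsmall : #(Set.Iio r.stem.len) < κ := by simpa using mk_Iio_lt r.stem.len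
  have hev : ∀ᶠ α in (U : Filter κ.ord.ToType), ∀ β : Set.Iio r.stem.len, s.len ≤ β.1 →
      r.stem.val β ∉ (p α).promise β := by
    refine (Filter.eventually_cardinal_forall hsmall).2 fun β => ?_
    by_cases hβ : s.len ≤ β.1
    · simpa [hβ] using Ultrafilter.eventually_not.2 (havoid β.1 β.2 hβ)
    · simp [hβ]
  obtain ⟨α, hα, hαA⟩ := (hev.and hA).exists
  have hstem : (p α).stem = s := (hp α).1
  refine ⟨α, hαA, ⟨r.stem, fun β => r.promise β ∪ (p α).promise β,
    isSlalom_union hκ r.isSlalom_promise (p α).isSlalom_promise⟩, ?_, ?_⟩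
  · exact ⟨⟨le_rfl, fun _ _ => rfl⟩, fun _ => Set.subset_union_left,
      fun _ h h' => absurd h h'.not_gt⟩
  · subst hstem
    exact ⟨⟨hlen, hval⟩, fun _ => Set.subset_union_right, fun β hβ h => hα ⟨β, hβ⟩ h⟩

end EvDiff

theorem mainTheorem2 (κ : Cardinal.{u}) (U : Ultrafilter κ.ord.ToType)
    (hcomplete : CardinalInterFilter (U : Filter κ.ord.ToType) κ)
    (hnonprincipal : ∀ α : κ.ord.ToType, U ≠ pure α) :
    IsCardFilterLinked (EvDiff κ) κ (U : Filter κ.ord.ToType) ∧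
    #(ShortSeq κ × κ.ord.ToType) = κ ∧
    (⋃ sl : ShortSeq κ × κ.ord.ToType, EvDiff.piece sl.1 sl.2) = Set.univ ∧
    (∀ sl sl' : ShortSeq κ × κ.ord.ToType, sl ≠ sl' →
      Disjoint (EvDiff.piece sl.1 sl.2) (EvDiff.piece sl'.1 sl'.2)) ∧
    ∀ (s : ShortSeq κ) (l : κ.ord.ToType),
      IsFilterLinked (U : Filter κ.ord.ToType) (EvDiff.piece s l) := by
  have hκ := isRegular_of_nonprincipal hnonprincipal
  have hcard : #(ShortSeq κ × κ.ord.ToType) = κ := by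
    rw [mk_prod, lift_id, lift_id, mk_ord_toType,
      mk_shortSeq hκ (isStrongPrelimit_of_nonprincipal hnonprincipal), mul_eq_self hκ.aleph0_le]
  have hlinked := EvDiff.isFilterLinked_piece U hκ.aleph0_le
  refine ⟨?_, hcard, EvDiff.iUnion_piece, fun _ _ => EvDiff.disjoint_piece, hlinked⟩
  obtain ⟨e⟩ := Cardinal.eq.1 ((mk_ord_toType κ).trans hcard.symm)
  refine ⟨fun α => EvDiff.piece (e α).1 (e α).2, ?_, fun α => hlinked _ _⟩
  rw [← EvDiff.iUnion_piece, e.surjective.iUnion_comp fun sl => EvDiff.piece sl.1 sl.2]
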